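/- Let $x_1,\dots,x_n\in\mathbb{R}^d$ and $y_1,\dots,y_n\in\{-1,+1\}$, and let $\ell:\mathbb{R}\to\mathbb{R}$ be strictly decreasing with $\lim_{z\to\infty}\ell(z)=0$ and twice continuously differentiable with $\ell''>0$. Define the empirical risk $$\mathcal{R}(w):=\frac1n\sum_{i=1}^n \ell\big(y_i\langle w,x_i\rangle\big),\qquad w\in\mathbb{R}^d .$$ Decompose the data as follows: $(x_i,y_i)\in D_c$ if there is a unit vector $u$ with $y_i\langle u,x_i\rangle>0$ and $y_j\langle u,x_j\rangle\ge 0$ for all $1\le j\le n$; otherwise $(x_i,y_i)\in D_s$. Let $$\mathcal{R}_s(w):=\frac1n\sum_{(x_i,y_i)\in D_s}\ell\big(y_i\langle w,x_i\rangle\big),\qquad S:=\operatorname{span}\{x_i:(x_i,y_i)\in D_s\},$$ and let $\Pi_S$ be the orthogonal projection onto $S$. Let $(w_t)_{t\ge0}$ be gradient descent iterates $w_{t+1}=w_t-\eta\nabla\mathcal{R}(w_t)$ from an arbitrary $w_0\in\mathbb{R}^d$ with a constant step size $\eta>0$, where $\eta\le 1/(2\mathcal{R}(w_0))$ and, for some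 $t_0\ge 0$, $$\mathcal{R}(w_{t+1})-\mathcal{R}(w_t)\le-\frac{\eta}{2}\,\|\nabla\mathcal{R}(w_t)\|^2\qquad\text{for all } t\ge t_0 .$$ For each $B\ge0$ let $\bar w(B)\in\arg\min_{\|w\|\le B}\mathcal{R}(w)$ (any choice of minimizer, if there are several). Then: (1) $\mathcal{R}_s$ has a unique minimizer $\bar v$ over $S$, and $\lim_{t\to\infty}\Pi_S w_t=\bar v$ and $\lim_{B\to\infty}\Pi_S\bar w(B)=\bar v$. (2) If $D_c\neq\emptyset$, then $\lim_{t\to\infty}\|w_t\|=\lim_{B\to\infty}\|\bar w(B)\|=\infty$; moreover $\lim_{t\to\infty}w_t/\|w_t\|$ exists if and only if $\lim_{B\to\infty}\bar w(B)/B$ exists, and when they exist they are equal and lie in $S^\perp$. -/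

import Mathlib

namespace LinearERM

/-- The part of the empirical risk carried by the examples with index in `I`:
`(1/n) ∑_{i ∈ I} ℓ(y_i ⟨w, x_i⟩)`, where `n` is the size of the whole data set. -/
noncomputable def partialRisk {n d : ℕ} (ℓ : ℝ → ℝ) (x : Fin n → EuclideanSpace ℝ (Fin d))
    (y : Fin n → ℝ) (I : Finset (Fin n)) (w : EuclideanSpace ℝ (Fin d)) : ℝ :=
  (1 / (n : ℝ)) * ∑ i ∈ I, ℓ (y i * inner ℝ w (x i))

/-- The empirical risk `R(w) = (1/n) ∑_i ℓ(y_i ⟨w, x_i⟩)`. -/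
noncomputable def risk {n d : ℕ} (ℓ : ℝ → ℝ) (x : Fin n → EuclideanSpace ℝ (Fin d))
    (y : Fin n → ℝ) (w : EuclideanSpace ℝ (Fin d)) : ℝ :=
  partialRisk ℓ x y Finset.univ w

open scoped Classical in
/-- The indices of `D_c`: those `i` for which some unit vector `u` has
`y_i ⟨u, x_i⟩ > 0` and `y_j ⟨u, x_j⟩ ≥ 0` for all `j`. -/
noncomputable def partC {n d : ℕ} (x : Fin n → EuclideanSpace ℝ (Fin d))
    (y : Fin n → ℝ) : Finset (Fin n) :=
  Finset.univ.filter fun i =>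
    ∃ u : EuclideanSpace ℝ (Fin d), ‖u‖ = 1 ∧ 0 < y i * inner ℝ u (x i) ∧
      ∀ j, 0 ≤ y j * inner ℝ u (x j)

/-- The indices of `D_s`, the complement of `D_c`. -/
noncomputable def partS {n d : ℕ} (x : Fin n → EuclideanSpace ℝ (Fin d))
    (y : Fin n → ℝ) : Finset (Fin n) :=
  (partC x y)ᶜ

/-- The risk `R_s` of the part `D_s`. -/
noncomputable def riskS {n d : ℕ} (ℓ : ℝ → ℝ) (x : Fin n → EuclideanSpace ℝ (Fin d))
    (y : Fin n → ℝ) (w : EuclideanSpace ℝ (Fin d)) : ℝ :=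
  partialRisk ℓ x y (partS x y) w

/-- The subspace `S` spanned by the inputs `x_i` of `D_s`. -/
noncomputable def spanS {n d : ℕ} (x : Fin n → EuclideanSpace ℝ (Fin d))
    (y : Fin n → ℝ) : Submodule ℝ (EuclideanSpace ℝ (Fin d)) :=
  Submodule.span ℝ (x '' {i | i ∈ partS x y})

/-- `w` is the sequence of gradient descent iterates for `f` with constant step size `η`. -/
def IsGradientDescent {d : ℕ} (f : EuclideanSpace ℝ (Fin d) → ℝ) (η : ℝ)
    (w : ℕ → EuclideanSpace ℝ (Fin d)) : Prop :=
  ∀ t, w (t + 1) = w t - η • gradient f (w t)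

/-- `wbar` is a regularization path of `f`: for every `B ≥ 0` the point `wbar B` minimizes `f`
over the closed Euclidean ball of radius `B` (any selection, if minimizers are not unique). -/
def IsRegularizationPath {d : ℕ} (f : EuclideanSpace ℝ (Fin d) → ℝ)
    (wbar : ℝ → EuclideanSpace ℝ (Fin d)) : Prop :=
  ∀ B : ℝ, 0 ≤ B → ‖wbar B‖ ≤ B ∧ ∀ w, ‖w‖ ≤ B → f (wbar B) ≤ f w

end LinearERM

/-! Gradient descent is used only through convexity and sufficient decrease, which give `‖w (t + 1)
- z‖² ≤ ‖w t - z‖² + 2η(f z - f (w (t + 1)))` for every `z`: the risk falls to its infimum, and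
iterates approach every point of smaller risk.

Some direction has positive margins on `D_c` and zero margins on `D_s`, so the `D_c` part of the
risk can be made negligible without changing `R_s`, and the infimum of the risk is the minimum of
`R_s`. On `S`, `R_s` is strictly convex and coercive, so projections of risk-minimizing families
converge to its minimizer. If `D_c` is nonempty the infimum is not attained, so such families
diverge.

If the iterates have a limit direction `u`, compare the last iterates before the first exits from
the balls of radii `(1 - δ)B` and `B`. The later is no farther from `wbar B`, whose risk is smaller;
after division by `B` this forces `wbar B / B` to correlate with `u`
(`tendsto_path_of_tendsto_direction`).

Conversely, the limit `u` of the path has strictly positive margins on `D_c`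
(`margin_pos_of_tendsto_path`); otherwise optimality of `wbar B` would make `-ℓ'` comparable at
geometrically growing scales, contradicting `z ℓ'(z) → 0`. Hence slightly extended points on the ray
along `u` have no larger risk than distant points (`risk_ray_le`), and a monotone potential turns
the iterates towards `u` (`tendsto_direction_of_ray`). -/

open Filter Topology
open scoped RealInnerProductSpace

namespace LinearERM

/-! ### Convex descent sequences in an inner product space -/

section Descent

variable {E : Type*} [NormedAddCommGroup E] [InnerProductSpace ℝ E]

/-- A lower bound on the correlation of two vectors in the unit ball makes them close. -/
theorem norm_sub_lt_of_inner {a u : E} (ha : ‖a‖ ≤ 1) (hu : ‖u‖ ≤ 1) {ε δ : ℝ}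
    (hε : 0 < ε) (hδ : 2 * δ < ε ^ 2) (h : 1 - δ ≤ ⟪a, u⟫) : ‖a - u‖ < ε := by
  refine lt_of_pow_lt_pow_left₀ 2 hε.le ?_
  rw [norm_sub_sq_real]
  have h1 : ‖a‖ ^ 2 ≤ 1 := pow_le_one₀ (norm_nonneg _) ha
  have h2 : ‖u‖ ^ 2 ≤ 1 := pow_le_one₀ (norm_nonneg _) hu
  linarith

/-- Sequences that behave like gradient descent with step size `η` on a convex function `f`: the
steps satisfy the first-order convexity inequality and a sufficient decrease condition. -/
structure IsConvexDescent (f : E → ℝ) (η : ℝ) (w : ℕ → E) : Prop where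
  first_order : ∀ t z, η * (f (w t) - f z) ≤ ⟪w (t + 1) - w t, z - w t⟫
  decrease : ∀ t, ‖w (t + 1) - w t‖ ^ 2 ≤ 2 * η * (f (w t) - f (w (t + 1)))

namespace IsConvexDescent

variable {f : E → ℝ} {η : ℝ} {w : ℕ → E}

theorem antitone (h : IsConvexDescent f η w) (hη : 0 < η) : Antitone (fun t => f (w t)) := by
  refine antitone_nat_of_succ_le fun t => ?_
  have h1 := (sq_nonneg ‖w (t + 1) - w t‖).trans (h.decrease t)
  have h2 : 0 ≤ f (w t) - f (w (t + 1)) := nonneg_of_mul_nonneg_right h1 (by positivity)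
  linarith

/-- Expanding the square, convexity controls the cross term and sufficient decrease absorbs the
squared step. -/
theorem dist_sq_succ_le (h : IsConvexDescent f η w) (t : ℕ) (z : E) :
    ‖w (t + 1) - z‖ ^ 2 ≤ ‖w t - z‖ ^ 2 + 2 * η * (f z - f (w (t + 1))) := by
  have h1 := h.first_order t z
  have h2 := h.decrease t
  have e : w (t + 1) - z = (w (t + 1) - w t) - (z - w t) := by abel
  have e' : ‖w t - z‖ = ‖z - w t‖ := norm_sub_rev _ _
  rw [e, e', norm_sub_sq_real]
  linarith

theorem dist_le_of_le (h : IsConvexDescent f η w) (hη : 0 < η) {s t : ℕ} (hst : s ≤ t) {z : E}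
    (hz : f z ≤ f (w t)) : ‖w t - z‖ ≤ ‖w s - z‖ := by
  induction t, hst using Nat.le_induction with
  | base => exact le_rfl
  | succ t hst ih =>
    refine le_trans ?_ (ih (hz.trans (h.antitone hη (Nat.le_succ t))))
    have h1 := h.dist_sq_succ_le t z
    have h2 : 2 * η * (f z - f (w (t + 1))) ≤ 0 :=
      mul_nonpos_of_nonneg_of_nonpos (by positivity) (by linarith)
    exact le_of_sq_le_sq (by linarith) (norm_nonneg _)

/-- Summing the distance inequality, with monotonicity of `f (w t)`, gives the usual `O(1/t)` bound
on the gap to any comparator. -/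
theorem eventually_lt (h : IsConvexDescent f η w) (hη : 0 < η) (z : E) {ε : ℝ} (hε : 0 < ε) :
    ∀ᶠ t in atTop, f (w t) < f z + ε := by
  have key : ∀ t : ℕ, ‖w t - z‖ ^ 2 + 2 * η * t * (f (w t) - f z) ≤ ‖w 0 - z‖ ^ 2 := by
    intro t
    induction t with
    | zero => simp
    | succ t ih =>
      have h1 := h.dist_sq_succ_le t z
      have h2 : 2 * η * t * (f (w (t + 1)) - f z) ≤ 2 * η * t * (f (w t) - f z) :=
        mul_le_mul_of_nonneg_left (sub_le_sub_right (h.antitone hη (Nat.le_succ t)) _)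
          (by positivity)
      push_cast
      linarith
  have ht : Tendsto (fun t : ℕ => 2 * η * ε * (t : ℝ)) atTop atTop :=
    tendsto_natCast_atTop_atTop.const_mul_atTop (by positivity)
  filter_upwards [ht.eventually_gt_atTop (‖w 0 - z‖ ^ 2)] with t ht
  by_contra! hcon
  have h1 := key t
  have h2 : 2 * η * t * ε ≤ 2 * η * t * (f (w t) - f z) :=
    mul_le_mul_of_nonneg_left (by linarith) (by positivity)
  nlinarith [sq_nonneg ‖w t - z‖]

theorem exists_norm_step_le (h : IsConvexDescent f η w) (hη : 0 < η) (hf : ∀ z, 0 ≤ f z) :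
    ∃ K, ∀ t, ‖w (t + 1) - w t‖ ≤ K := by
  refine ⟨√(2 * η * f (w 0)), fun t => Real.le_sqrt_of_sq_le ((h.decrease t).trans ?_)⟩
  refine mul_le_mul_of_nonneg_left ?_ (by positivity)
  have := h.antitone hη (Nat.zero_le t)
  have := hf (w (t + 1))
  simp only at *
  linarith

/-- If descent iterates converge in direction, so does every regularization path, and the limit is
the same. -/
theorem tendsto_path_of_tendsto_direction (h : IsConvexDescent f η w) (hη : 0 < η)
    (hf : ∀ z, 0 ≤ f z) {wbar : ℝ → E}
    (hpath : ∀ B : ℝ, 0 ≤ B → ‖wbar B‖ ≤ B ∧ ∀ z, ‖z‖ ≤ B → f (wbar B) ≤ f z)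
    (hnorm : Tendsto (fun t => ‖w t‖) atTop atTop) {u : E}
    (hu : Tendsto (fun t => (1 / ‖w t‖) • w t) atTop (𝓝 u)) :
    Tendsto (fun B => (1 / B) • wbar B) atTop (𝓝 u) := by
  obtain ⟨K, hK⟩ := h.exists_norm_step_le hη hf
  have hu1 : ‖u‖ = 1 := by
    refine tendsto_nhds_unique hu.norm (tendsto_const_nhds.congr' ?_)
    filter_upwards [hnorm.eventually_gt_atTop 0] with t ht
    rw [norm_smul, norm_div, norm_one, norm_norm, one_div_mul_cancel ht.ne']
  -- `τ B` is the last time before the first exit from the ball of radius `B`; if `w 0` already lies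
  -- outside, its value is irrelevant.
  have hcross : ∀ B : ℝ, ∃ t, ‖w 0‖ ≤ B → (∀ s ≤ t, ‖w s‖ ≤ B) ∧ B < ‖w (t + 1)‖ := by
    intro B
    by_cases hB : ‖w 0‖ ≤ B
    · classical
      have hex : ∃ t, B < ‖w t‖ := (hnorm.eventually_gt_atTop B).exists
      have hpos : Nat.find hex ≠ 0 := by
        intro h0
        have := Nat.find_spec hex
        rw [h0] at this
        linarith
      obtain ⟨t, ht⟩ := Nat.exists_eq_succ_of_ne_zero hpos
      refine ⟨t, fun _ => ⟨fun s hs => ?_, ?_⟩⟩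
      · exact not_lt.1 (Nat.find_min hex (by omega))
      · have := Nat.find_spec hex
        rwa [ht] at this
    · exact ⟨0, fun h => absurd h hB⟩
  choose τ hτ using hcross
  have hτ_top : Tendsto τ atTop atTop := by
    refine tendsto_atTop.2 fun N => ?_
    filter_upwards [eventually_ge_atTop (∑ s ∈ Finset.range (N + 1), ‖w s‖)] with B hB
    have hle : ∀ s ≤ N, ‖w s‖ ≤ B := fun s hs =>
      (Finset.single_le_sum (f := fun s => ‖w s‖) (fun _ _ => norm_nonneg _)
        (Finset.mem_range.2 (by omega))).trans hB
    by_contra! hlt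
    exact absurd (hle (τ B + 1) hlt) (not_le.2 (hτ B (hle 0 (Nat.zero_le N))).2)
  -- The step bound `K` limits the overshoot at the exit, so `B - K ≤ ‖w (τ B)‖ ≤ B`.
  have hratio : Tendsto (fun B => ‖w (τ B)‖ / B) atTop (𝓝 1) := by
    have hlow : Tendsto (fun B : ℝ => 1 - K / B) atTop (𝓝 1) := by
      simpa using (tendsto_const_nhds (x := (1 : ℝ))).sub
        ((tendsto_const_nhds (x := K)).div_atTop tendsto_id)
    refine tendsto_of_tendsto_of_tendsto_of_le_of_le' hlow tendsto_const_nhds ?_ ?_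
    · filter_upwards [eventually_gt_atTop 0, eventually_ge_atTop ‖w 0‖] with B hB hB0
      rw [← sub_nonneg]
      have h1 := (hτ B hB0).2
      have h2 := norm_le_norm_add_norm_sub' (w (τ B + 1)) (w (τ B))
      have h3 := hK (τ B)
      have : ‖w (τ B)‖ / B - (1 - K / B) = (‖w (τ B)‖ - B + K) / B := by
        field_simp
        ring
      rw [this]
      exact div_nonneg (by linarith) hB.le
    · filter_upwards [eventually_gt_atTop 0, eventually_ge_atTop ‖w 0‖] with B hB hB0
      exact (div_le_one hB).2 ((hτ B hB0).1 _ le_rfl)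
  have hpoint : Tendsto (fun B => (1 / B) • w (τ B)) atTop (𝓝 u) := by
    have h1 := hratio.smul (hu.comp hτ_top)
    rw [one_smul] at h1
    refine h1.congr' ?_
    filter_upwards [(hnorm.comp hτ_top).eventually_gt_atTop 0] with B hB
    simp only [Function.comp_apply] at hB ⊢
    rw [smul_smul]
    congr 1
    field_simp
  rw [Metric.tendsto_nhds]
  intro ε hε
  obtain ⟨δ, hδ0, hδ1, hδε⟩ : ∃ δ : ℝ, 0 < δ ∧ δ < 1 ∧ 2 * δ < ε ^ 2 := by
    refine ⟨min (1 / 2) (ε ^ 2 / 4), by positivity, ?_, ?_⟩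
    · exact (min_le_left _ _).trans_lt (by norm_num)
    · have := min_le_right (1 / 2) (ε ^ 2 / 4)
      have : 0 < ε ^ 2 := by positivity
      linarith
  have hscale : Tendsto (fun B : ℝ => (1 - δ) * B) atTop atTop :=
    tendsto_id.const_mul_atTop (by linarith)
  have hpoint' : Tendsto (fun B => (1 / B) • w (τ ((1 - δ) * B))) atTop (𝓝 ((1 - δ) • u)) := by
    refine ((hpoint.comp hscale).const_smul (1 - δ)).congr fun B => ?_
    simp only [Function.comp_apply]
    rw [smul_smul]
    congr 1
    have : 1 - δ ≠ 0 := by linarith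
    field_simp
  -- With `p`, `q`, `a` the rescaled `w (τ B)`, `w (τ ((1 - δ) * B))`, `wbar B`, the bound `‖p - a‖
  -- ≤ ‖q - a‖` says `2⟪p - q, a⟫ ≥ ‖p‖² - ‖q‖²`. Since `p - q` tends to `δ • u` and the right side
  -- to `2δ - δ²`, this yields `⟪a, u⟫ ≥ 1 - δ`.
  have hgap : Tendsto (fun B => ‖(1 / B) • w (τ B)‖ ^ 2 - ‖(1 / B) • w (τ ((1 - δ) * B))‖ ^ 2 -
      2 * ‖(1 / B) • w (τ B) - (1 / B) • w (τ ((1 - δ) * B)) - δ • u‖) atTop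
      (𝓝 (‖u‖ ^ 2 - ‖(1 - δ) • u‖ ^ 2 - 2 * ‖u - (1 - δ) • u - δ • u‖)) :=
    ((hpoint.norm.pow 2).sub (hpoint'.norm.pow 2)).sub
      (((hpoint.sub hpoint').sub tendsto_const_nhds).norm.const_mul 2)
  have hval : ‖u‖ ^ 2 - ‖(1 - δ) • u‖ ^ 2 - 2 * ‖u - (1 - δ) • u - δ • u‖ = 2 * δ - δ ^ 2 := by
    have : u - (1 - δ) • u - δ • u = 0 := by module
    rw [this, norm_smul, hu1, norm_zero, mul_one, Real.norm_eq_abs, sq_abs]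
    ring
  rw [hval] at hgap
  have hlt : 2 * δ - 2 * δ ^ 2 < 2 * δ - δ ^ 2 := by nlinarith
  filter_upwards [hgap.eventually_const_lt hlt, eventually_gt_atTop 0,
    eventually_ge_atTop ‖w 0‖, hscale.eventually_ge_atTop ‖w 0‖] with B hgapB hB hB0 hB0'
  rw [dist_eq_norm]
  have ha : ‖(1 / B) • wbar B‖ ≤ 1 := by
    rw [norm_smul, Real.norm_of_nonneg (by positivity), one_div, inv_mul_le_iff₀ hB, mul_one]
    exact (hpath B hB.le).1
  refine norm_sub_lt_of_inner ha hu1.le hε hδε ?_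
  have hττ : τ ((1 - δ) * B) ≤ τ B := by
    by_contra! hcon
    have h1 := (hτ _ hB0').1 (τ B + 1) hcon
    have h2 := (hτ _ hB0).2
    nlinarith
  have hdist := h.dist_le_of_le hη hττ ((hpath B hB.le).2 _ ((hτ _ hB0).1 _ le_rfl))
  have hdist' : ‖(1 / B) • w (τ B) - (1 / B) • wbar B‖ ≤
      ‖(1 / B) • w (τ ((1 - δ) * B)) - (1 / B) • wbar B‖ := by
    rw [← smul_sub, ← smul_sub, norm_smul, norm_smul]
    exact mul_le_mul_of_nonneg_left hdist (norm_nonneg _)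
  generalize (1 / B) • w (τ B) = p at *
  generalize (1 / B) • w (τ ((1 - δ) * B)) = q at *
  generalize (1 / B) • wbar B = a at *
  have h1 := pow_le_pow_left₀ (norm_nonneg _) hdist' 2
  rw [norm_sub_sq_real, norm_sub_sq_real] at h1
  have h2 : ⟪p - q - δ • u, a⟫ ≤ ‖p - q - δ • u‖ :=
    (real_inner_le_norm _ _).trans (mul_le_of_le_one_right (norm_nonneg _) ha)
  rw [inner_sub_left, inner_sub_left, real_inner_smul_left] at h2
  rw [real_inner_comm]
  nlinarith

/-- If far away points are dominated by points on a ray in direction `u`, then descent iterates of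
diverging norm converge to `u` in direction. -/
theorem tendsto_direction_of_ray (h : IsConvexDescent f η w) (hη : 0 < η)
    (hf : ∀ z, 0 ≤ f z) (hnorm : Tendsto (fun t => ‖w t‖) atTop atTop) {u v : E} (hu : ‖u‖ ≤ 1)
    (hray : ∀ α > 0, ∃ ρ, ∀ z, ρ ≤ ‖z‖ → f (v + ((1 + α) * ‖z - v‖) • u) ≤ f z) :
    Tendsto (fun t => (1 / ‖w t‖) • w t) atTop (𝓝 u) := by
  rw [Metric.tendsto_nhds]
  intro ε hε
  obtain ⟨α, hα0, hαε⟩ : ∃ α : ℝ, 0 < α ∧ 2 * (2 * α) < ε ^ 2 :=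
    ⟨ε ^ 2 / 8, by positivity, by nlinarith [sq_pos_of_pos hε]⟩
  obtain ⟨ρ, hρ⟩ := hray α hα0
  obtain ⟨T, hT⟩ := eventually_atTop.1
    ((hnorm.eventually_ge_atTop ρ).and (hnorm.eventually_ge_atTop (‖v‖ + 1)))
  -- A potential that never decreases: convexity at the ray point compares the change of `‖w t - v‖`
  -- with that of `⟪w t, u⟫`, and the term `η * f (w t)` pays for the squared step once `‖w t - v‖ ≥
  -- 1`.
  let P : ℕ → ℝ := fun t => (1 + α) * ⟪w t, u⟫ - ‖w t - v‖ - η * f (w t)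
  have hstep : ∀ t, T ≤ t → P t ≤ P (t + 1) := by
    intro t ht
    obtain ⟨ht1, ht2⟩ := hT t ht
    have hq : 1 ≤ ‖w t - v‖ := by
      have := norm_le_norm_add_norm_sub' (w t) v
      linarith
    have h1 := h.first_order t (v + ((1 + α) * ‖w t - v‖) • u)
    have h2 := h.decrease t
    have h3 : 0 ≤ η * (f (w t) - f (v + ((1 + α) * ‖w t - v‖) • u)) :=
      mul_nonneg hη.le (sub_nonneg.2 (hρ _ ht1))
    have e : v + ((1 + α) * ‖w t - v‖) • u - w t = ((1 + α) * ‖w t - v‖) • u - (w t - v) := by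
      abel
    rw [e, inner_sub_right, real_inner_smul_right] at h1
    have e2 : w (t + 1) - v = (w (t + 1) - w t) + (w t - v) := by abel
    have h4 : ‖w (t + 1) - v‖ ^ 2 = ‖w (t + 1) - w t‖ ^ 2 +
        2 * ⟪w (t + 1) - w t, w t - v⟫ + ‖w t - v‖ ^ 2 := by rw [e2, norm_add_sq_real]
    have e3 : ⟪w (t + 1), u⟫ = ⟪w (t + 1) - w t, u⟫ + ⟪w t, u⟫ := by
      rw [inner_sub_left]; ring
    simp only [P, e3]
    generalize ‖w (t + 1) - v‖ = q' at *
    generalize ‖w t - v‖ = q at *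
    generalize ⟪w (t + 1) - w t, u⟫ = a at *
    generalize ⟪w (t + 1) - w t, w t - v⟫ = b at *
    generalize ‖w (t + 1) - w t‖ ^ 2 = D at *
    have hdec : 0 ≤ η * (f (w t) - f (w (t + 1))) :=
      mul_nonneg hη.le (sub_nonneg.2 (h.antitone hη (Nat.le_succ t)))
    have h5 : 0 ≤ q * ((1 + α) * a - (q' - q) + η * (f (w t) - f (w (t + 1)))) := by
      nlinarith [sq_nonneg (q' - q), mul_le_mul_of_nonneg_right hq hdec]
    have := nonneg_of_mul_nonneg_right h5 (by linarith)
    linarith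
  have hmono : ∀ t, T ≤ t → P T ≤ P t := by
    intro t ht
    induction t, ht using Nat.le_induction with
    | base => exact le_rfl
    | succ t ht ih => exact ih.trans (hstep t ht)
  filter_upwards [eventually_ge_atTop T, hnorm.eventually_gt_atTop 0,
    hnorm.eventually_ge_atTop ((‖v‖ - P T) / α)] with t ht hpos hlarge
  rw [dist_eq_norm]
  refine norm_sub_lt_of_inner ?_ hu hε hαε ?_
  · rw [norm_smul, norm_div, norm_one, norm_norm, one_div_mul_cancel hpos.ne']
  · have h1 := hmono t ht
    have h2 : 0 ≤ η * f (w t) := mul_nonneg hη.le (hf _)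
    have h3 := norm_le_norm_add_norm_sub' (w t) v
    have h4 : (‖v‖ - P T) ≤ ‖w t‖ * α := (div_le_iff₀ hα0).1 hlarge
    have h5 : (1 - α) * ‖w t‖ ≤ (1 + α) * ⟪w t, u⟫ := by
      have : P t = (1 + α) * ⟪w t, u⟫ - ‖w t - v‖ - η * f (w t) := rfl
      nlinarith
    rw [real_inner_smul_left, one_div, ← div_eq_inv_mul, le_div_iff₀ hpos]
    -- `(1 - α) / (1 + α) ≥ 1 - 2α`, hence the choice of `α` with `2 * (2 * α) < ε ^ 2`.
    have h6 : (1 + α) * ((1 - 2 * α) * ‖w t‖) ≤ (1 + α) * ⟪w t, u⟫ := by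
      nlinarith [mul_nonneg (sq_nonneg α) hpos.le]
    exact le_of_mul_le_mul_left h6 (by linarith)

end IsConvexDescent

end Descent

/-! ### Tail behaviour of the loss -/

section Loss

/-- Strictly decreasing, strictly convex `C²` losses that vanish at infinity. -/
structure IsLoss (ℓ : ℝ → ℝ) : Prop where
  anti : StrictAnti ℓ
  lim : Tendsto ℓ atTop (𝓝 0)
  smooth : ContDiff ℝ 2 ℓ
  deriv2_pos : ∀ z, 0 < deriv (deriv ℓ) z

namespace IsLoss

variable {ℓ : ℝ → ℝ}

theorem pos (h : IsLoss ℓ) (z : ℝ) : 0 < ℓ z :=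
  (h.anti.antitone.le_of_tendsto h.lim (z + 1)).trans_lt (h.anti (lt_add_one z))

theorem differentiable (h : IsLoss ℓ) : Differentiable ℝ ℓ :=
  h.smooth.differentiable (by norm_num)

theorem continuous (h : IsLoss ℓ) : Continuous ℓ := h.differentiable.continuous

theorem continuous_deriv (h : IsLoss ℓ) : Continuous (deriv ℓ) :=
  h.smooth.continuous_deriv (by norm_num)

theorem strictConvexOn (h : IsLoss ℓ) : StrictConvexOn ℝ Set.univ ℓ :=
  strictConvexOn_univ_of_deriv2_pos h.continuous fun z => h.deriv2_pos z

theorem strictMono_deriv (h : IsLoss ℓ) : StrictMono (deriv ℓ) :=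
  strictMono_of_deriv_pos h.deriv2_pos

theorem deriv_neg (h : IsLoss ℓ) (z : ℝ) : deriv ℓ z < 0 :=
  (h.strictMono_deriv (lt_add_one z)).trans_le h.anti.antitone.deriv_nonpos

theorem tangent_le (h : IsLoss ℓ) (a b : ℝ) : ℓ a + deriv ℓ a * (b - a) ≤ ℓ b := by
  rcases lt_trichotomy a b with hab | rfl | hab
  · have := h.strictConvexOn.convexOn.deriv_le_slope (Set.mem_univ a) (Set.mem_univ b) hab
      (h.differentiable a)
    rw [slope_def_field, le_div_iff₀ (by linarith)] at this
    linarith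
  · simp
  · have := h.strictConvexOn.convexOn.slope_le_deriv (Set.mem_univ b) (Set.mem_univ a) hab
      (h.differentiable a)
    rw [slope_def_field, div_le_iff₀ (by linarith)] at this
    linarith

theorem mul_max_le (h : IsLoss ℓ) (z : ℝ) : -deriv ℓ 0 * max 0 (-z) ≤ ℓ z := by
  rcases max_cases 0 (-z) with ⟨hm, -⟩ | ⟨hm, -⟩ <;> rw [hm]
  · simpa using (h.pos z).le
  · have h1 := h.tangent_le 0 z
    have h2 := h.pos 0
    linarith

/-- The tangent at `z`, evaluated at `z / 2`, gives `z * -ℓ'(z) ≤ 2 * ℓ(z / 2)`. -/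
theorem tendsto_mul_deriv (h : IsLoss ℓ) :
    Tendsto (fun z => z * -deriv ℓ z) atTop (𝓝 0) := by
  have h1 : Tendsto (fun z : ℝ => 2 * ℓ (z / 2)) atTop (𝓝 0) := by
    simpa using (h.lim.comp (tendsto_id.atTop_div_const two_pos)).const_mul 2
  refine squeeze_zero' ?_ ?_ h1
  · filter_upwards [eventually_ge_atTop 0] with z hz
    exact mul_nonneg hz (neg_nonneg.2 (h.deriv_neg z).le)
  · filter_upwards with z
    have h1 := h.tangent_le z (z / 2)
    have h2 := h.pos z
    linarith

/-- The slope of an integrable convex tail cannot stay comparable at geometrically growing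
scales. -/
theorem not_eventually_deriv_le (h : IsLoss ℓ) {C : ℝ} (hC : 1 < C) :
    ¬ ∀ᶠ b in atTop, -deriv ℓ (b / C) ≤ C * -deriv ℓ b := by
  intro hev
  obtain ⟨b₀, hb₀⟩ := eventually_atTop.1 (hev.and (eventually_gt_atTop 0))
  have hb₀pos : 0 < b₀ := (hb₀ b₀ le_rfl).2
  have hC0 : 0 < C := by linarith
  have hge : ∀ k : ℕ, b₀ ≤ C ^ k * b₀ := fun k =>
    le_mul_of_one_le_left hb₀pos.le (one_le_pow₀ hC.le)
  -- Iterating the comparison keeps `z * -ℓ'(z)` bounded below along `z = C ^ k * b₀`.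
  have hk : ∀ k : ℕ, b₀ * -deriv ℓ b₀ ≤ (C ^ k * b₀) * -deriv ℓ (C ^ k * b₀) := by
    intro k
    induction k with
    | zero => simp
    | succ k ih =>
      have h1 := (hb₀ _ (hge (k + 1))).1
      have e : C ^ (k + 1) * b₀ / C = C ^ k * b₀ := by
        rw [pow_succ]
        field_simp
      rw [e] at h1
      have h2 := mul_le_mul_of_nonneg_left h1 (by positivity : 0 ≤ C ^ k * b₀)
      calc _ ≤ _ := ih
        _ ≤ _ := h2
        _ = _ := by ring
  have htop : Tendsto (fun k : ℕ => C ^ k * b₀) atTop atTop :=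
    (tendsto_pow_atTop_atTop_of_one_lt hC).atTop_mul_const hb₀pos
  have := ge_of_tendsto' (h.tendsto_mul_deriv.comp htop) hk
  exact absurd this (not_le.2 (mul_pos hb₀pos (neg_pos.2 (h.deriv_neg b₀))))

end IsLoss

end Loss

/-! ### Geometry of the decomposition and coercivity of `R_s` -/

section Data

variable {n d : ℕ} {ℓ : ℝ → ℝ} (x : Fin n → EuclideanSpace ℝ (Fin d)) (y : Fin n → ℝ)

/-- The margin `w ↦ y_i ⟨w, x_i⟩` of the `i`-th example. -/
noncomputable def margin (i : Fin n) : EuclideanSpace ℝ (Fin d) →L[ℝ] ℝ :=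
  y i • innerSL ℝ (x i)

theorem margin_apply (i : Fin n) (w : EuclideanSpace ℝ (Fin d)) :
    margin x y i w = y i * inner ℝ w (x i) := by
  simp [margin, real_inner_comm]

theorem partialRisk_eq (ℓ : ℝ → ℝ) (I : Finset (Fin n)) (w : EuclideanSpace ℝ (Fin d)) :
    partialRisk ℓ x y I w = (1 / (n : ℝ)) * ∑ i ∈ I, ℓ (margin x y i w) := by
  simp only [partialRisk, margin_apply]

theorem mem_partC_iff {i : Fin n} : i ∈ partC x y ↔
    ∃ u : EuclideanSpace ℝ (Fin d), 0 < margin x y i u ∧ ∀ j, 0 ≤ margin x y j u := by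
  simp only [partC, Finset.mem_filter, Finset.mem_univ, true_and, ← margin_apply]
  refine ⟨fun ⟨u, _, h⟩ => ⟨u, h⟩, fun ⟨u, hi, hj⟩ => ?_⟩
  have hu : u ≠ 0 := by
    rintro rfl
    simp at hi
  have hu' : 0 < ‖u‖⁻¹ := inv_pos.2 (norm_pos_iff.2 hu)
  refine ⟨‖u‖⁻¹ • u, norm_smul_inv_norm hu, ?_, fun j => ?_⟩ <;> rw [map_smul, smul_eq_mul]
  · exact mul_pos hu' hi
  · exact mul_nonneg hu'.le (hj j)

theorem notMem_partC_iff {i : Fin n} : i ∉ partC x y ↔ i ∈ partS x y := by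
  simp [partS]

/-- There is a direction that separates `D_c` strictly and is orthogonal to `D_s`. -/
theorem exists_separating : ∃ u : EuclideanSpace ℝ (Fin d), ‖u‖ ≤ 1 ∧
    (∀ i ∈ partC x y, 0 < margin x y i u) ∧ ∀ j ∈ partS x y, margin x y j u = 0 := by
  have hex : ∀ i, ∃ u : EuclideanSpace ℝ (Fin d), (∀ j, 0 ≤ margin x y j u) ∧
      (i ∈ partC x y → 0 < margin x y i u) := by
    intro i
    by_cases hi : i ∈ partC x y
    · obtain ⟨u, h1, h2⟩ := (mem_partC_iff x y).1 hi
      exact ⟨u, h2, fun _ => h1⟩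
    · exact ⟨0, by simp, fun h => absurd h hi⟩
  choose U hU hU' using hex
  let u := ∑ i, U i
  have hu : ∀ j, 0 ≤ margin x y j u := fun j => by
    rw [map_sum]
    exact Finset.sum_nonneg fun i _ => hU i j
  have huC : ∀ i ∈ partC x y, 0 < margin x y i u := fun i hi => by
    rw [map_sum]
    exact Finset.sum_pos' (fun k _ => hU k i) ⟨i, Finset.mem_univ i, hU' i hi⟩
  -- A positive margin at `j` would make `u` a certificate for `j ∈ partC x y`.
  have huS : ∀ j ∈ partS x y, margin x y j u = 0 := fun j hj => by
    by_contra hne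
    exact (notMem_partC_iff x y).2 hj
      ((mem_partC_iff x y).2 ⟨u, lt_of_le_of_ne (hu j) (Ne.symm hne), hu⟩)
  -- Scaling by `1 + ‖u‖` also covers `u = 0`, which occurs when `D_c` is empty.
  have hpos : 0 < (1 + ‖u‖)⁻¹ := by positivity
  refine ⟨(1 + ‖u‖)⁻¹ • u, ?_, fun i hi => ?_, fun j hj => ?_⟩
  · rw [norm_smul, Real.norm_of_nonneg hpos.le, inv_mul_le_iff₀ (by positivity)]
    linarith
  · rw [map_smul, smul_eq_mul]
    exact mul_pos hpos (huC i hi)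
  · rw [map_smul, huS j hj, smul_zero]

variable {y}

theorem mem_spanS_orthogonal_iff (hy : ∀ i, y i ≠ 0) {u : EuclideanSpace ℝ (Fin d)} :
    u ∈ (spanS x y)ᗮ ↔ ∀ j ∈ partS x y, margin x y j u = 0 := by
  have key : ∀ j, margin x y j u = 0 ↔ inner ℝ (x j) u = 0 := fun j => by
    rw [margin_apply, mul_eq_zero, or_iff_right (hy j), real_inner_comm]
  rw [Submodule.mem_orthogonal]
  constructor
  · intro h j hj
    exact (key j).2 (h _ (Submodule.subset_span ⟨j, hj, rfl⟩))
  · intro h v hv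
    induction hv using Submodule.span_induction with
    | mem v hv =>
      obtain ⟨j, hj, rfl⟩ := hv
      exact (key j).1 (h j hj)
    | zero => simp
    | add a b _ _ ha hb => rw [inner_add_left, ha, hb, add_zero]
    | smul c a _ ha => rw [inner_smul_left, ha, mul_zero]

theorem margin_starProjection (hy : ∀ i, y i ≠ 0) {j : Fin n} (hj : j ∈ partS x y)
    (w : EuclideanSpace ℝ (Fin d)) :
    margin x y j ((spanS x y).starProjection w) = margin x y j w := by
  have h := (mem_spanS_orthogonal_iff x hy).1
    ((spanS x y).sub_starProjection_mem_orthogonal w) j hj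
  rw [map_sub] at h
  linarith

theorem riskS_congr {v w : EuclideanSpace ℝ (Fin d)}
    (h : ∀ j ∈ partS x y, margin x y j v = margin x y j w) : riskS ℓ x y v = riskS ℓ x y w := by
  rw [riskS, riskS, partialRisk_eq, partialRisk_eq]
  congr 1
  exact Finset.sum_congr rfl fun j hj => by rw [h j hj]

theorem riskS_starProjection (hy : ∀ i, y i ≠ 0) (w : EuclideanSpace ℝ (Fin d)) :
    riskS ℓ x y ((spanS x y).starProjection w) = riskS ℓ x y w :=
  riskS_congr x fun _ hj => margin_starProjection x hy hj w

variable (y) in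
theorem risk_eq_add (w : EuclideanSpace ℝ (Fin d)) :
    risk ℓ x y w = partialRisk ℓ x y (partC x y) w + riskS ℓ x y w := by
  rw [risk, riskS, partS, partialRisk, partialRisk, partialRisk, ← mul_add,
    Finset.sum_add_sum_compl]

variable (y) in
theorem partialRisk_nonneg (hℓ : IsLoss ℓ) (I : Finset (Fin n)) (w : EuclideanSpace ℝ (Fin d)) :
    0 ≤ partialRisk ℓ x y I w :=
  mul_nonneg (by positivity) (Finset.sum_nonneg fun _ _ => (hℓ.pos _).le)

variable (y) in
theorem partialRisk_pos (hn : 0 < n) (hℓ : IsLoss ℓ) {I : Finset (Fin n)} (hI : I.Nonempty)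
    (w : EuclideanSpace ℝ (Fin d)) : 0 < partialRisk ℓ x y I w :=
  mul_pos (by positivity) (Finset.sum_pos (fun _ _ => hℓ.pos _) hI)

variable (y) in
theorem riskS_le_risk (hℓ : IsLoss ℓ) (w : EuclideanSpace ℝ (Fin d)) :
    riskS ℓ x y w ≤ risk ℓ x y w := by
  rw [risk_eq_add]
  linarith [partialRisk_nonneg x y hℓ (partC x y) w]

variable (y) in
theorem continuous_partialRisk (hℓ : IsLoss ℓ) (I : Finset (Fin n)) :
    Continuous (partialRisk ℓ x y I) := by
  rw [funext (partialRisk_eq x y ℓ I)]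
  exact continuous_const.mul (continuous_finsetSum _ fun i _ =>
    hℓ.continuous.comp (margin x y i).continuous)

variable (y) in
theorem partialRisk_tangent_le (hℓ : IsLoss ℓ) (I : Finset (Fin n))
    (v w : EuclideanSpace ℝ (Fin d)) :
    partialRisk ℓ x y I w + (1 / (n : ℝ)) * ∑ i ∈ I, deriv ℓ (margin x y i w) *
      margin x y i (v - w) ≤ partialRisk ℓ x y I v := by
  rw [partialRisk_eq, partialRisk_eq, ← mul_add, ← Finset.sum_add_distrib]
  refine mul_le_mul_of_nonneg_left (Finset.sum_le_sum fun i _ => ?_) (by positivity)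
  rw [map_sub]
  exact hℓ.tangent_le _ _

variable (y) in
theorem inner_gradient_risk (hℓ : IsLoss ℓ) (w v : EuclideanSpace ℝ (Fin d)) :
    ⟪gradient (risk ℓ x y) w, v⟫ =
      (1 / (n : ℝ)) * ∑ i, deriv ℓ (margin x y i w) * margin x y i v := by
  have h : HasFDerivAt (risk ℓ x y)
      ((1 / (n : ℝ)) • ∑ i, deriv ℓ (margin x y i w) • margin x y i) w := by
    have e : risk ℓ x y = fun w => (1 / (n : ℝ)) * ∑ i, ℓ (margin x y i w) :=
      funext (partialRisk_eq x y ℓ Finset.univ)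
    rw [e]
    refine (HasFDerivAt.fun_sum fun i _ => ?_).const_mul _
    exact (hℓ.differentiable _).hasDerivAt.comp_hasFDerivAt w (margin x y i).hasFDerivAt
  rw [gradient, InnerProductSpace.toDual_symm_apply, h.fderiv]
  simp

/-- Every nonzero vector of `S` has a negative margin on `D_s`, uniformly. -/
theorem exists_mul_norm_le_sum_max (hy : ∀ i, y i ≠ 0) : ∃ c > 0, ∀ v ∈ spanS x y,
    c * ‖v‖ ≤ ∑ j ∈ partS x y, max 0 (-margin x y j v) := by
  let F : EuclideanSpace ℝ (Fin d) → ℝ := fun v => ∑ j ∈ partS x y, max 0 (-margin x y j v)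
  have hF : Continuous F := continuous_finsetSum _ fun j _ =>
    continuous_const.max (margin x y j).continuous.neg
  have hpos : ∀ v ∈ spanS x y, v ≠ 0 → 0 < F v := by
    intro v hv hv0
    have h0 : 0 ≤ F v := Finset.sum_nonneg fun _ _ => le_max_left _ _
    refine lt_of_le_of_ne h0 fun heq => hv0 ?_
    have hnn : ∀ j ∈ partS x y, 0 ≤ margin x y j v := fun j hj => by
      have := (Finset.sum_eq_zero_iff_of_nonneg (fun _ _ => le_max_left _ _)).1 heq.symm j hj
      have := (le_max_right _ _).trans this.le
      linarith
    obtain ⟨u, -, huC, huS⟩ := exists_separating x y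
    -- Adding a large multiple of `u` repairs the margins on `D_c` and leaves those on `D_s`
    -- unchanged. Any positive margin on `D_s` would then contradict membership in `D_s`, so `v`
    -- lies in `S ∩ Sᗮ`.
    obtain ⟨k, hk⟩ : ∃ k : ℝ, ∀ i ∈ partC x y, 0 ≤ margin x y i (v + k • u) := by
      have : ∀ᶠ k : ℝ in atTop, ∀ i ∈ partC x y, 0 ≤ margin x y i (v + k • u) := by
        rw [Filter.eventually_all_finset]
        intro i hi
        have ht : Tendsto (fun k : ℝ => margin x y i v + k * margin x y i u) atTop atTop :=
          tendsto_atTop_add_const_left _ _ (tendsto_id.atTop_mul_const (huC i hi))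
        filter_upwards [ht.eventually_ge_atTop 0] with k hk
        simpa using hk
      exact this.exists
    have hS : ∀ j ∈ partS x y, margin x y j (v + k • u) = margin x y j v := fun j hj => by
      simp [huS j hj]
    have hall : ∀ j, 0 ≤ margin x y j (v + k • u) := fun j => by
      by_cases hj : j ∈ partC x y
      · exact hk j hj
      · have hj := (notMem_partC_iff x y).1 hj
        rw [hS j hj]
        exact hnn j hj
    have hzero : ∀ j ∈ partS x y, margin x y j v = 0 := fun j hj => by
      by_contra hne
      refine (notMem_partC_iff x y).2 hj ((mem_partC_iff x y).2 ⟨v + k • u, ?_, hall⟩)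
      rw [hS j hj]
      exact lt_of_le_of_ne (hnn j hj) (Ne.symm hne)
    have := (mem_spanS_orthogonal_iff x hy).2 hzero v hv
    exact inner_self_eq_zero.1 this
  have hcomp : IsCompact (Metric.sphere (0 : EuclideanSpace ℝ (Fin d)) 1 ∩ spanS x y) :=
    (isCompact_sphere _ _).inter_right (spanS x y).closed_of_finiteDimensional
  have hc : ∃ c > 0, ∀ v ∈ Metric.sphere (0 : EuclideanSpace ℝ (Fin d)) 1 ∩ spanS x y,
      c ≤ F v := by
    refine hcomp.exists_forall_le' hF.continuousOn fun v hv => hpos v hv.2 ?_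
    rintro rfl
    simpa using hv.1
  obtain ⟨c, hc0, hc⟩ := hc
  refine ⟨c, hc0, fun v hv => ?_⟩
  rcases eq_or_ne v 0 with rfl | hv0
  · simp
  have hvpos : 0 < ‖v‖ := norm_pos_iff.2 hv0
  have h1 := hc (‖v‖⁻¹ • v) ⟨mem_sphere_zero_iff_norm.2 (norm_smul_inv_norm hv0),
    (spanS x y).smul_mem _ hv⟩
  have h2 : F (‖v‖⁻¹ • v) = ‖v‖⁻¹ * F v := by
    simp only [F, Finset.mul_sum]
    refine Finset.sum_congr rfl fun j _ => ?_
    rw [map_smul, smul_eq_mul, mul_max_of_nonneg _ _ (inv_nonneg.2 hvpos.le), mul_zero, mul_neg]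
  rwa [h2, ← div_eq_inv_mul, le_div_iff₀ hvpos] at h1

/-- Coercivity on `S`: the loss dominates a multiple of the negative part of the margin. -/
theorem exists_mul_norm_le_riskS (hn : 0 < n) (hℓ : IsLoss ℓ) (hy : ∀ i, y i ≠ 0) :
    ∃ κ > 0, ∀ v ∈ spanS x y, κ * ‖v‖ ≤ riskS ℓ x y v := by
  obtain ⟨c, hc0, hc⟩ := exists_mul_norm_le_sum_max x hy
  have ha : 0 < -deriv ℓ 0 := neg_pos.2 (hℓ.deriv_neg 0)
  have hn' : 0 < 1 / (n : ℝ) := by positivity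
  refine ⟨1 / (n : ℝ) * (-deriv ℓ 0 * c), by positivity, fun v hv => ?_⟩
  rw [riskS, partialRisk_eq, mul_assoc, mul_assoc]
  refine mul_le_mul_of_nonneg_left ?_ hn'.le
  refine (mul_le_mul_of_nonneg_left (hc v hv) ha.le).trans ?_
  rw [Finset.mul_sum]
  exact Finset.sum_le_sum fun j _ => hℓ.mul_max_le _

/-- `R_s` has a unique minimizer over `S`. -/
theorem exists_riskS_minimizer (hn : 0 < n) (hℓ : IsLoss ℓ) (hy : ∀ i, y i ≠ 0) :
    ∃ v ∈ spanS x y, ∀ v' ∈ spanS x y, v' ≠ v → riskS ℓ x y v < riskS ℓ x y v' := by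
  obtain ⟨κ, hκ0, hκ⟩ := exists_mul_norm_le_riskS x hn hℓ hy
  have hcont : Continuous (riskS ℓ x y) := continuous_partialRisk x y hℓ _
  let K := Metric.closedBall (0 : EuclideanSpace ℝ (Fin d)) (riskS ℓ x y 0 / κ) ∩ spanS x y
  have hK : IsCompact K :=
    (isCompact_closedBall _ _).inter_right (spanS x y).closed_of_finiteDimensional
  have h0 : (0 : EuclideanSpace ℝ (Fin d)) ∈ K :=
    ⟨Metric.mem_closedBall_self (div_nonneg (partialRisk_nonneg x y hℓ _ _) hκ0.le),
      zero_mem _⟩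
  obtain ⟨v, hvK, hvmin⟩ := hK.exists_isMinOn ⟨0, h0⟩ hcont.continuousOn
  have hmin : ∀ v' ∈ spanS x y, riskS ℓ x y v ≤ riskS ℓ x y v' := by
    intro v' hv'
    by_cases hn' : ‖v'‖ ≤ riskS ℓ x y 0 / κ
    · exact hvmin ⟨by simpa using hn', hv'⟩
    · rw [not_le, div_lt_iff₀ hκ0] at hn'
      have := hκ v' hv'
      have h2 : riskS ℓ x y v ≤ riskS ℓ x y 0 := hvmin h0
      linarith
  refine ⟨v, hvK.2, fun v' hv' hne => lt_of_le_of_ne (hmin v' hv') fun heq => ?_⟩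
  -- Distinct points of `S` differ in some `D_s` margin, so strict convexity applies at the
  -- midpoint.
  obtain ⟨j, hj, hjne⟩ : ∃ j ∈ partS x y, margin x y j v ≠ margin x y j v' := by
    by_contra! hall
    refine hne (sub_eq_zero.1 ?_)
    have := (mem_spanS_orthogonal_iff x hy (u := v' - v)).2 fun j hj => by
      rw [map_sub, hall j hj, sub_self]
    exact inner_self_eq_zero.1 (this _ (sub_mem hv' hvK.2))
  have hmid := hmin ((1 / 2 : ℝ) • v + (1 / 2 : ℝ) • v')
    (add_mem (Submodule.smul_mem _ _ hvK.2) (Submodule.smul_mem _ _ hv'))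
  have hlt : riskS ℓ x y ((1 / 2 : ℝ) • v + (1 / 2 : ℝ) • v') <
      (1 / 2) * riskS ℓ x y v + (1 / 2) * riskS ℓ x y v' := by
    simp only [riskS, partialRisk_eq]
    have e : ∀ a b c : ℝ, 1 / 2 * (a * b) + 1 / 2 * (a * c) = a * ((b + c) / 2) :=
      fun a b c => by ring
    rw [e, ← Finset.sum_add_distrib, Finset.sum_div]
    refine mul_lt_mul_of_pos_left (Finset.sum_lt_sum (fun i _ => ?_) ⟨j, hj, ?_⟩) (by positivity)
    · have := hℓ.strictConvexOn.convexOn.2 (Set.mem_univ (margin x y i v))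
        (Set.mem_univ (margin x y i v')) (by norm_num : (0 : ℝ) ≤ 1 / 2)
        (by norm_num : (0 : ℝ) ≤ 1 / 2) (by norm_num)
      simp only [map_add, map_smul, smul_eq_mul] at this ⊢
      linarith
    · have := hℓ.strictConvexOn.2 (Set.mem_univ (margin x y j v))
        (Set.mem_univ (margin x y j v')) hjne (by norm_num : (0 : ℝ) < 1 / 2)
        (by norm_num : (0 : ℝ) < 1 / 2) (by norm_num)
      simp only [map_add, map_smul, smul_eq_mul] at this ⊢
      linarith
  linarith

end Data

/-! ### Risk-minimizing families and their limit directions -/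

section Limits

variable {n d : ℕ} {ℓ : ℝ → ℝ} (x : Fin n → EuclideanSpace ℝ (Fin d)) {y : Fin n → ℝ}

/-- The infimum of the risk is at most the infimum of `R_s`. -/
theorem exists_risk_lt (hℓ : IsLoss ℓ) (v : EuclideanSpace ℝ (Fin d)) {ε : ℝ} (hε : 0 < ε) :
    ∃ z, risk ℓ x y z < riskS ℓ x y v + ε := by
  obtain ⟨u, -, huC, huS⟩ := exists_separating x y
  have ht : Tendsto (fun s : ℝ => partialRisk ℓ x y (partC x y) (v + s • u)) atTop (𝓝 0) := by
    have h1 : Tendsto (fun s : ℝ => (1 / (n : ℝ)) * ∑ i ∈ partC x y, ℓ (margin x y i (v + s • u)))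
        atTop (𝓝 ((1 / (n : ℝ)) * ∑ i ∈ partC x y, (0 : ℝ))) := by
      refine (tendsto_finsetSum _ fun i hi => hℓ.lim.comp ?_).const_mul _
      have : Tendsto (fun k : ℝ => margin x y i v + k * margin x y i u) atTop atTop :=
        tendsto_atTop_add_const_left _ _ (tendsto_id.atTop_mul_const (huC i hi))
      simpa using this
    simpa [partialRisk_eq] using h1
  obtain ⟨s, hs⟩ := (ht.eventually_lt_const hε).exists
  refine ⟨v + s • u, ?_⟩
  have e : riskS ℓ x y (v + s • u) = riskS ℓ x y v := riskS_congr x fun j hj => by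
    simp [huS j hj]
  rw [risk_eq_add, e]
  linarith

/-- Along risk-minimizing families the projection onto `S` converges to the minimizer of `R_s`. -/
theorem tendsto_starProjection (hn : 0 < n) (hℓ : IsLoss ℓ) (hy : ∀ i, y i ≠ 0)
    {v : EuclideanSpace ℝ (Fin d)}
    (hmin : ∀ v' ∈ spanS x y, v' ≠ v → riskS ℓ x y v < riskS ℓ x y v')
    {ι : Type*} {l : Filter ι} {p : ι → EuclideanSpace ℝ (Fin d)}
    (hp : ∀ ε > 0, ∀ᶠ a in l, risk ℓ x y (p a) < riskS ℓ x y v + ε) :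
    Tendsto (fun a => (spanS x y).starProjection (p a)) l (𝓝 v) := by
  obtain ⟨κ, hκ0, hκ⟩ := exists_mul_norm_le_riskS x hn hℓ hy
  have hcont : Continuous (riskS ℓ x y) := continuous_partialRisk x y hℓ _
  have hp' : ∀ ε > 0, ∀ᶠ a in l,
      riskS ℓ x y ((spanS x y).starProjection (p a)) < riskS ℓ x y v + ε := by
    intro ε hε
    filter_upwards [hp ε hε] with a ha
    rw [riskS_starProjection x hy]
    exact (riskS_le_risk x y hℓ _).trans_lt ha
  have hK : IsCompact
      (Metric.closedBall (0 : EuclideanSpace ℝ (Fin d)) ((riskS ℓ x y v + 1) / κ) ∩ spanS x y) :=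
    (isCompact_closedBall _ _).inter_right (spanS x y).closed_of_finiteDimensional
  refine hK.tendsto_nhds_of_unique_mapClusterPt ?_ fun q hq hclust => ?_
  · filter_upwards [hp' 1 one_pos] with a ha
    have hmem := (spanS x y).starProjection_apply_mem (p a)
    refine ⟨?_, hmem⟩
    rw [mem_closedBall_zero_iff, le_div_iff₀ hκ0, mul_comm]
    exact (hκ _ hmem).trans ha.le
  · by_contra hne
    have hlt := hmin q hq.2 hne
    obtain ⟨r, hr1, hr2⟩ := exists_between hlt
    have h1 : ∀ᶠ z in 𝓝 q, r < riskS ℓ x y z := hcont.continuousAt.eventually_const_lt hr2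
    have h2 := hp' (r - riskS ℓ x y v) (by linarith)
    obtain ⟨a, ha1, ha2⟩ := ((hclust.frequently h1).and_eventually h2).exists
    linarith

/-- Risk-minimizing families diverge when `D_c` is nonempty. -/
theorem tendsto_norm_atTop (hn : 0 < n) (hℓ : IsLoss ℓ) (hy : ∀ i, y i ≠ 0)
    (hC : (partC x y).Nonempty) {v : EuclideanSpace ℝ (Fin d)}
    (hmin : ∀ v' ∈ spanS x y, v' ≠ v → riskS ℓ x y v < riskS ℓ x y v')
    {ι : Type*} {l : Filter ι} {p : ι → EuclideanSpace ℝ (Fin d)}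
    (hp : ∀ ε > 0, ∀ᶠ a in l, risk ℓ x y (p a) < riskS ℓ x y v + ε) :
    Tendsto (fun a => ‖p a‖) l atTop := by
  have hcont : Continuous (risk ℓ x y) := continuous_partialRisk x y hℓ _
  have hgt : ∀ z, riskS ℓ x y v < risk ℓ x y z := by
    intro z
    have h1 := partialRisk_pos x y hn hℓ hC z
    have h2 : riskS ℓ x y v ≤ riskS ℓ x y z := by
      rw [← riskS_starProjection x hy z]
      rcases eq_or_ne ((spanS x y).starProjection z) v with h | h
      · rw [h]
      · exact (hmin _ ((spanS x y).starProjection_apply_mem z) h).le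
    rw [risk_eq_add]
    linarith
  refine tendsto_atTop.2 fun M => ?_
  obtain ⟨r, hr, hrM⟩ := (isCompact_closedBall (0 : EuclideanSpace ℝ (Fin d)) M).exists_forall_le'
    hcont.continuousOn fun z _ => hgt z
  filter_upwards [hp (r - riskS ℓ x y v) (by linarith)] with a ha
  by_contra! hlt
  have := hrM (p a) (mem_closedBall_zero_iff.2 hlt.le)
  linarith

/-- First-order optimality for minimizers of the risk over a segment. -/
theorem sum_deriv_nonneg_of_segment (hn : 0 < n) (hℓ : IsLoss ℓ) {p q : EuclideanSpace ℝ (Fin d)}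
    (h : ∀ τ : ℝ, 0 < τ → τ < 1 → risk ℓ x y p ≤ risk ℓ x y (p + τ • (q - p))) :
    0 ≤ ∑ i, deriv ℓ (margin x y i p) * margin x y i (q - p) := by
  let G : ℝ → ℝ := fun τ => ∑ i, deriv ℓ (margin x y i (p + τ • (q - p))) * margin x y i (q - p)
  have hG : Continuous G := continuous_finsetSum _ fun i _ =>
    (hℓ.continuous_deriv.comp ((margin x y i).continuous.comp (by fun_prop))).mul
      continuous_const
  have h0 : G 0 = ∑ i, deriv ℓ (margin x y i p) * margin x y i (q - p) := by simp [G]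
  rw [← h0]
  have ht : Tendsto G (𝓝[>] 0) (𝓝 (G 0)) := hG.continuousAt.tendsto.mono_left nhdsWithin_le_nhds
  refine ge_of_tendsto ht ?_
  filter_upwards [Ioo_mem_nhdsGT (zero_lt_one' ℝ)] with τ hτ
  have h1 := h τ hτ.1 hτ.2
  -- The tangent at the interior point, evaluated back at `p`, gives `0 ≤ G τ`; continuity then
  -- passes to `τ = 0`.
  have h2 := partialRisk_tangent_le x y hℓ Finset.univ p (p + τ • (q - p))
  have e : ∀ i, margin x y i (p - (p + τ • (q - p))) = -τ * margin x y i (q - p) := fun i => by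
    rw [sub_add_cancel_left, ← neg_smul, map_smul, smul_eq_mul]
  have e2 : ∑ i, deriv ℓ (margin x y i (p + τ • (q - p))) *
      margin x y i (p - (p + τ • (q - p))) = -τ * G τ := by
    simp only [G, e, Finset.mul_sum]
    exact Finset.sum_congr rfl fun i _ => by ring
  rw [e2] at h2
  rw [risk, risk] at h1
  have h3 : 0 ≤ (1 / (n : ℝ) * τ) * G τ := by linarith
  exact nonneg_of_mul_nonneg_right h3 (mul_pos (by positivity) hτ.1)

/-- The limit direction of a regularization path separates `D_c` strictly. -/
theorem margin_pos_of_tendsto_path (hn : 0 < n) (hℓ : IsLoss ℓ) (hy : ∀ i, y i ≠ 0)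
    {wbar : ℝ → EuclideanSpace ℝ (Fin d)} (hwbar : IsRegularizationPath (risk ℓ x y) wbar)
    {u v : EuclideanSpace ℝ (Fin d)}
    (hproj : Tendsto (fun B => (spanS x y).starProjection (wbar B)) atTop (𝓝 v))
    (hu : Tendsto (fun B => (1 / B) • wbar B) atTop (𝓝 u)) :
    ∀ i ∈ partC x y, 0 < margin x y i u := by
  intro i₀ hi₀
  by_contra! hneg
  obtain ⟨s, hs1, hsC, hsS⟩ := exists_separating x y
  obtain ⟨γ, hγ0, hγ⟩ : ∃ γ > 0, ∀ i ∈ partC x y, γ ≤ margin x y i s := by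
    refine ⟨(partC x y).inf' ⟨i₀, hi₀⟩ fun i => margin x y i s, ?_, fun i hi =>
      Finset.inf'_le _ hi⟩
    exact (Finset.lt_inf'_iff _).2 hsC
  let X : ℝ := ∑ i, ‖margin x y i‖
  have hX0 : 0 ≤ X := Finset.sum_nonneg fun _ _ => norm_nonneg _
  have hX : ∀ i z, |margin x y i z| ≤ X * ‖z‖ := fun i z =>
    ((margin x y i).le_opNorm z).trans (mul_le_mul_of_nonneg_right
      (Finset.single_le_sum (f := fun i => ‖margin x y i‖) (fun _ _ => norm_nonneg _)
        (Finset.mem_univ i)) (norm_nonneg _))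
  let M : ℝ := ‖v‖ + 1
  have hM : ∀ᶠ B in atTop, ‖(spanS x y).starProjection (wbar B)‖ < M :=
    hproj.norm.eventually_lt_const (lt_add_one _)
  -- `4 * n * X / γ` is the constant of the final estimate `hfin`; the added `2` gives `b / C ≤ b /
  -- 2`.
  let C : ℝ := 4 * n * X / γ + 2
  have hC : 2 ≤ C := by
    have : 0 ≤ 4 * n * X / γ := by positivity
    simp only [C]
    linarith
  refine hℓ.not_eventually_deriv_le (by linarith : 1 < C) ?_
  have hsmall : ∀ᶠ B in atTop, margin x y i₀ ((1 / B) • wbar B) < γ / 2 / C :=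
    (((margin x y i₀).continuous.tendsto u).comp hu).eventually_lt_const
      (hneg.trans_lt (by positivity))
  have hscale : Tendsto (fun b : ℝ => b * (2 / γ)) atTop atTop :=
    tendsto_id.atTop_mul_const (by positivity)
  have hmain : ∀ᶠ B in atTop, -deriv ℓ (γ / 2 * B / C) ≤ C * -deriv ℓ (γ / 2 * B) := by
    filter_upwards [hM, hsmall, eventually_gt_atTop 0, eventually_ge_atTop M,
      eventually_ge_atTop (2 / γ * (X * M + M * γ))] with B hMB hsB hB hBM hBlarge
    set p := (spanS x y).starProjection (wbar B) with hp
    set b := γ / 2 * B with hb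
    have hb0 : 0 < b := by positivity
    have hwB := (hwbar B hB.le).1
    -- The competitor keeps the `D_s` margins of `wbar B`, spends the remaining radius on `s`, and
    -- has margins at least `b` on `D_c`.
    let q := p + (B - M) • s
    have hq : ‖q‖ ≤ B := by
      have h1 : ‖(B - M) • s‖ ≤ B - M := by
        rw [norm_smul, Real.norm_of_nonneg (by linarith)]
        exact mul_le_of_le_one_right (by linarith) hs1
      have := norm_add_le p ((B - M) • s)
      simp only [q]
      linarith
    have hopt : 0 ≤ ∑ i, deriv ℓ (margin x y i (wbar B)) * margin x y i (q - wbar B) := by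
      refine sum_deriv_nonneg_of_segment x hn hℓ fun τ hτ0 hτ1 => (hwbar B hB.le).2 _ ?_
      have := convex_closedBall (0 : EuclideanSpace ℝ (Fin d)) B |>.add_smul_sub_mem
        (mem_closedBall_zero_iff.2 hwB) (mem_closedBall_zero_iff.2 hq) ⟨hτ0.le, hτ1.le⟩
      exact mem_closedBall_zero_iff.1 this
    have hzero : ∑ j ∈ (partC x y)ᶜ,
        deriv ℓ (margin x y j (wbar B)) * margin x y j (q - wbar B) = 0 := by
      refine Finset.sum_eq_zero fun j hj => ?_
      have hj : j ∈ partS x y := hj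
      have : margin x y j (q - wbar B) = 0 := by
        rw [map_sub, map_add, map_smul, hsS j hj, hp, margin_starProjection x hy hj]
        simp
      rw [this, mul_zero]
    rw [← Finset.sum_add_sum_compl (partC x y), hzero, add_zero] at hopt
    have hqi : ∀ i ∈ partC x y, b ≤ margin x y i q := by
      intro i hi
      have h1 := (abs_le.1 (hX i p)).1
      have h2 : X * ‖p‖ ≤ X * M := mul_le_mul_of_nonneg_left hMB.le hX0
      have h3 : (B - M) * γ ≤ (B - M) * margin x y i s :=
        mul_le_mul_of_nonneg_left (hγ i hi) (by linarith)
      have h4 : X * M + M * γ ≤ b := by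
        have := mul_le_mul_of_nonneg_left hBlarge (by positivity : 0 ≤ γ / 2)
        calc X * M + M * γ = γ / 2 * (2 / γ * (X * M + M * γ)) := by field_simp
          _ ≤ b := this
      have h5 : b + b = B * γ := by rw [hb]; ring
      simp only [q, map_add, map_smul, smul_eq_mul]
      linarith
    have hgpos : ∀ z, 0 < -deriv ℓ z := fun z => neg_pos.2 (hℓ.deriv_neg z)
    have hganti : ∀ a c, a ≤ c → -deriv ℓ c ≤ -deriv ℓ a := fun a c hac =>
      neg_le_neg (hℓ.strictMono_deriv.monotone hac)
    let T : Fin n → ℝ := fun i => -deriv ℓ (margin x y i (wbar B)) * (b - margin x y i (wbar B))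
    have hsum : ∑ i ∈ partC x y, T i ≤ 0 := by
      have : ∑ i ∈ partC x y, T i ≤ ∑ i ∈ partC x y,
          -(deriv ℓ (margin x y i (wbar B)) * margin x y i (q - wbar B)) := by
        refine Finset.sum_le_sum fun i hi => ?_
        rw [← neg_mul, map_sub]
        exact mul_le_mul_of_nonneg_left (sub_le_sub_right (hqi i hi) _) (hgpos _).le
      rw [Finset.sum_neg_distrib] at this
      linarith
    let D : ℝ := -deriv ℓ b * (X * B)
    have hD0 : 0 ≤ D := mul_nonneg (hgpos b).le (mul_nonneg hX0 hB.le)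
    -- Examples with margin above `b` contribute at least `-D`, since `-ℓ'` is decreasing; hence the
    -- lagging example `i₀` contributes at most `n * D`.
    have hT : ∀ i, 0 ≤ T i + D := by
      intro i
      rcases le_total (margin x y i (wbar B)) b with hle | hle
      · exact add_nonneg (mul_nonneg (hgpos _).le (by linarith)) hD0
      · have h1 : margin x y i (wbar B) - b ≤ X * B := by
          have h1 := (abs_le.1 (hX i (wbar B))).2
          have h2 := mul_le_mul_of_nonneg_left hwB hX0
          linarith
        have h2 : -deriv ℓ (margin x y i (wbar B)) * (margin x y i (wbar B) - b) ≤ D :=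
          mul_le_mul (hganti _ _ hle) h1 (by linarith) (hgpos b).le
        simp only [T]
        linarith
    have hsingle : T i₀ ≤ n * D := by
      have h1 : T i₀ + D ≤ ∑ i ∈ partC x y, (T i + D) :=
        Finset.single_le_sum (f := fun i => T i + D) (fun i _ => hT i) hi₀
      rw [Finset.sum_add_distrib, Finset.sum_const, nsmul_eq_mul] at h1
      have h2 : ((partC x y).card : ℝ) * D ≤ n * D := by
        refine mul_le_mul_of_nonneg_right ?_ hD0
        exact_mod_cast (Finset.card_le_univ (partC x y)).trans_eq (Fintype.card_fin n)
      linarith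
    have hm : margin x y i₀ (wbar B) ≤ b / C := by
      rw [map_smul, smul_eq_mul, one_div, ← div_eq_inv_mul, div_lt_iff₀ hB] at hsB
      refine hsB.le.trans_eq ?_
      rw [hb]
      ring
    have hbC : b / C ≤ b / 2 := div_le_div_of_nonneg_left hb0.le two_pos hC
    have hlow : -deriv ℓ (b / C) * (b / 2) ≤ T i₀ :=
      mul_le_mul (hganti _ _ hm) (by linarith) (by linarith) (hgpos _).le
    have hfin : -deriv ℓ (b / C) * (b / 2) ≤ (4 * n * X / γ * -deriv ℓ b) * (b / 2) := by
      refine (hlow.trans hsingle).trans_eq ?_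
      simp only [D, hb]
      field_simp
      ring
    have := le_of_mul_le_mul_right hfin (by positivity)
    have h2 := hgpos b
    simp only [C] at this ⊢
    nlinarith
  filter_upwards [hscale.eventually hmain] with b hb
  have e : γ / 2 * (b * (2 / γ)) = b := by field_simp
  rwa [e] at hb

/-- Points of large norm are dominated by points on the ray in the limit direction of a
regularization path. -/
theorem risk_ray_le (hℓ : IsLoss ℓ) (hy : ∀ i, y i ≠ 0)
    {wbar : ℝ → EuclideanSpace ℝ (Fin d)} (hwbar : IsRegularizationPath (risk ℓ x y) wbar)
    {u v : EuclideanSpace ℝ (Fin d)}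
    (hmin : ∀ v' ∈ spanS x y, v' ≠ v → riskS ℓ x y v < riskS ℓ x y v')
    (huS : ∀ j ∈ partS x y, margin x y j u = 0) (huC : ∀ i ∈ partC x y, 0 < margin x y i u)
    (hu : Tendsto (fun B => (1 / B) • wbar B) atTop (𝓝 u)) {α : ℝ} (hα : 0 < α) :
    ∃ ρ, ∀ z, ρ ≤ ‖z‖ → risk ℓ x y (v + ((1 + α) * ‖z - v‖) • u) ≤ risk ℓ x y z := by
  have hC : ∀ᶠ B : ℝ in atTop, ∀ i ∈ partC x y,
      margin x y i (wbar B) ≤ margin x y i v + (1 + α) * (B - ‖v‖) * margin x y i u := by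
    rw [Filter.eventually_all_finset]
    intro i hi
    have h1 : Tendsto (fun B : ℝ => margin x y i ((1 / B) • wbar B) - (1 / B) * margin x y i v -
        (1 + α) * (1 - 1 / B * ‖v‖) * margin x y i u) atTop
        (𝓝 (margin x y i u - 0 * margin x y i v - (1 + α) * (1 - 0 * ‖v‖) * margin x y i u)) := by
      have hinv : Tendsto (fun B : ℝ => 1 / B) atTop (𝓝 0) :=
        tendsto_const_nhds.div_atTop tendsto_id
      exact ((((margin x y i).continuous.tendsto u).comp hu).sub (hinv.mul_const _)).sub
        (((tendsto_const_nhds.sub (hinv.mul_const _)).const_mul _).mul_const _)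
    -- The limit equals `-α * margin x y i u`: the factor `1 + α` leaves room for lower-order terms.
    have hlt : margin x y i u - 0 * margin x y i v - (1 + α) * (1 - 0 * ‖v‖) * margin x y i u
        < 0 := by
      nlinarith [huC i hi]
    filter_upwards [h1.eventually_lt_const hlt, eventually_gt_atTop 0] with B hB hB0
    rw [map_smul, smul_eq_mul] at hB
    have h2 := mul_neg_of_pos_of_neg hB0 hB
    have e : B * (1 / B * margin x y i (wbar B) - 1 / B * margin x y i v -
        (1 + α) * (1 - 1 / B * ‖v‖) * margin x y i u) = margin x y i (wbar B) - margin x y i v -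
        (1 + α) * (B - ‖v‖) * margin x y i u := by
      field_simp
    rw [e] at h2
    linarith
  obtain ⟨ρ, hρ⟩ := eventually_atTop.1 hC
  refine ⟨ρ, fun z hz => le_trans ?_ ((hwbar ‖z‖ (norm_nonneg z)).2 z le_rfl)⟩
  rw [risk_eq_add, risk_eq_add x y (wbar ‖z‖)]
  refine add_le_add ?_ ?_
  · rw [partialRisk_eq, partialRisk_eq]
    refine mul_le_mul_of_nonneg_left (Finset.sum_le_sum fun i hi => ?_) (by positivity)
    refine hℓ.anti.antitone ((hρ _ hz i hi).trans ?_)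
    rw [map_add, map_smul, smul_eq_mul]
    have h1 := norm_sub_norm_le z v
    have h2 : (1 + α) * (‖z‖ - ‖v‖) ≤ (1 + α) * ‖z - v‖ :=
      mul_le_mul_of_nonneg_left h1 (by linarith)
    have h3 := mul_le_mul_of_nonneg_right h2 (huC i hi).le
    linarith
  · have e : riskS ℓ x y (v + ((1 + α) * ‖z - v‖) • u) = riskS ℓ x y v :=
      riskS_congr x fun j hj => by simp [huS j hj]
    rw [e, ← riskS_starProjection x hy (wbar ‖z‖)]
    rcases eq_or_ne ((spanS x y).starProjection (wbar ‖z‖)) v with h | h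
    · rw [h]
    · exact (hmin _ ((spanS x y).starProjection_apply_mem _) h).le

/-- Gradient descent with sufficient decrease from time `t₀` on is a convex descent sequence. -/
theorem isConvexDescent_risk (hℓ : IsLoss ℓ) {η : ℝ} (hη : 0 < η)
    {w : ℕ → EuclideanSpace ℝ (Fin d)} (hw : IsGradientDescent (risk ℓ x y) η w) {t₀ : ℕ}
    (hdec : ∀ t ≥ t₀, risk ℓ x y (w (t + 1)) - risk ℓ x y (w t) ≤
      -(η / 2) * ‖gradient (risk ℓ x y) (w t)‖ ^ 2) :
    IsConvexDescent (risk ℓ x y) η (fun t => w (t + t₀)) := by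
  have hstep : ∀ t, w (t + 1 + t₀) - w (t + t₀) = -(η • gradient (risk ℓ x y) (w (t + t₀))) := by
    intro t
    rw [add_right_comm, hw]
    abel
  refine ⟨fun t z => ?_, fun t => ?_⟩
  · rw [hstep, inner_neg_left, real_inner_smul_left, inner_gradient_risk x y hℓ, ← mul_neg]
    refine mul_le_mul_of_nonneg_left ?_ hη.le
    have := partialRisk_tangent_le x y hℓ Finset.univ z (w (t + t₀))
    simp only [risk]
    linarith
  · rw [hstep, norm_neg, norm_smul, Real.norm_of_nonneg hη.le]
    have := mul_le_mul_of_nonneg_left (hdec (t + t₀) (by omega)) (by positivity : 0 ≤ 2 * η)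
    rw [add_right_comm t 1 t₀]
    nlinarith

/-- A limit direction is orthogonal to `S` if the projections onto `S` converge. -/
theorem mem_orthogonal_of_tendsto {ι : Type*} {l : Filter ι} [l.NeBot]
    {S : Submodule ℝ (EuclideanSpace ℝ (Fin d))} {p : ι → EuclideanSpace ℝ (Fin d)} {r : ι → ℝ}
    (hr : Tendsto r l atTop) {u v : EuclideanSpace ℝ (Fin d)}
    (hp : Tendsto (fun a => S.starProjection (p a)) l (𝓝 v))
    (hu : Tendsto (fun a => (1 / r a) • p a) l (𝓝 u)) : u ∈ Sᗮ := by
  have h1 : Tendsto (fun a => S.starProjection ((1 / r a) • p a)) l (𝓝 (S.starProjection u)) :=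
    (S.starProjection.continuous.tendsto u).comp hu
  have h2 : Tendsto (fun a => (1 / r a) • S.starProjection (p a)) l (𝓝 ((0 : ℝ) • v)) :=
    (tendsto_const_nhds.div_atTop hr).smul hp
  simp only [map_smul] at h1
  have h0 := tendsto_nhds_unique h1 h2
  rw [zero_smul] at h0
  have := S.sub_starProjection_mem_orthogonal u
  rwa [h0, sub_zero] at this

end Limits

end LinearERM

/-! ### Assembly of the main theorem -/

theorem mainTheorem3 {n d : ℕ}
    (x : Fin n → EuclideanSpace ℝ (Fin d)) (y : Fin n → ℝ)
    (hy : ∀ i, y i = -1 ∨ y i = 1)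
    (ℓ : ℝ → ℝ) (hℓ_anti : StrictAnti ℓ)
    (hℓ_lim : Filter.Tendsto ℓ Filter.atTop (nhds 0))
    (hℓ_smooth : ContDiff ℝ 2 ℓ) (hℓ_pos : ∀ z, 0 < deriv (deriv ℓ) z)
    (η : ℝ) (hη : 0 < η)
    (w : ℕ → EuclideanSpace ℝ (Fin d))
    (hw : LinearERM.IsGradientDescent (LinearERM.risk ℓ x y) η w)
    (wbar : ℝ → EuclideanSpace ℝ (Fin d))
    (hwbar : LinearERM.IsRegularizationPath (LinearERM.risk ℓ x y) wbar)
    (hη_le : η ≤ 1 / (2 * LinearERM.risk ℓ x y (w 0)))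
    (t₀ : ℕ)
    (hdec : ∀ t ≥ t₀, LinearERM.risk ℓ x y (w (t + 1)) - LinearERM.risk ℓ x y (w t) ≤
      -(η / 2) * ‖gradient (LinearERM.risk ℓ x y) (w t)‖ ^ 2) :
    (∃ v ∈ LinearERM.spanS x y,
      (∀ v' ∈ LinearERM.spanS x y, v' ≠ v → LinearERM.riskS ℓ x y v < LinearERM.riskS ℓ x y v') ∧
      Filter.Tendsto (fun t => (LinearERM.spanS x y).starProjection (w t))
        Filter.atTop (nhds v) ∧
      Filter.Tendsto (fun B => (LinearERM.spanS x y).starProjection (wbar B))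
        Filter.atTop (nhds v)) ∧
    ((LinearERM.partC x y).Nonempty →
      Filter.Tendsto (fun t => ‖w t‖) Filter.atTop Filter.atTop ∧
      Filter.Tendsto (fun B => ‖wbar B‖) Filter.atTop Filter.atTop ∧
      ((∃ u, Filter.Tendsto (fun t => (1 / ‖w t‖) • w t) Filter.atTop (nhds u)) ↔
        (∃ u, Filter.Tendsto (fun B => (1 / B) • wbar B) Filter.atTop (nhds u))) ∧
      (∀ u u', Filter.Tendsto (fun t => (1 / ‖w t‖) • w t) Filter.atTop (nhds u) →
        Filter.Tendsto (fun B => (1 / B) • wbar B) Filter.atTop (nhds u') →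
        u = u' ∧ u ∈ (LinearERM.spanS x y)ᗮ)) := by
  have hℓ : LinearERM.IsLoss ℓ := ⟨hℓ_anti, hℓ_lim, hℓ_smooth, hℓ_pos⟩
  have hy0 : ∀ i, y i ≠ 0 := fun i => by rcases hy i with h | h <;> rw [h] <;> norm_num
  -- For `n = 0` the risk is zero and division by zero turns `hη_le` into `η ≤ 0`.
  have hn : 0 < n := by
    rcases Nat.eq_zero_or_pos n with rfl | h
    · simp [LinearERM.risk, LinearERM.partialRisk] at hη_le
      linarith
    · exact h
  have hdesc := LinearERM.isConvexDescent_risk x hℓ hη hw hdec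
  have hnonneg : ∀ z, 0 ≤ LinearERM.risk ℓ x y z := LinearERM.partialRisk_nonneg x y hℓ _
  obtain ⟨v, hvS, hmin⟩ := LinearERM.exists_riskS_minimizer x hn hℓ hy0
  have hGD : ∀ ε > 0, ∀ᶠ t in atTop,
      LinearERM.risk ℓ x y (w t) < LinearERM.riskS ℓ x y v + ε := by
    intro ε hε
    obtain ⟨z, hz⟩ := LinearERM.exists_risk_lt x (y := y) hℓ v hε
    have h1 := hdesc.eventually_lt hη z (sub_pos.2 hz)
    rw [← map_add_atTop_eq_nat t₀, eventually_map]
    filter_upwards [h1] with t ht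
    linarith
  have hRP : ∀ ε > 0, ∀ᶠ B in atTop,
      LinearERM.risk ℓ x y (wbar B) < LinearERM.riskS ℓ x y v + ε := by
    intro ε hε
    obtain ⟨z, hz⟩ := LinearERM.exists_risk_lt x (y := y) hℓ v hε
    filter_upwards [eventually_ge_atTop ‖z‖] with B hB
    exact ((hwbar B ((norm_nonneg z).trans hB)).2 z hB).trans_lt hz
  have hGDproj := LinearERM.tendsto_starProjection x hn hℓ hy0 hmin hGD
  have hRPproj := LinearERM.tendsto_starProjection x hn hℓ hy0 hmin hRP
  refine ⟨⟨v, hvS, hmin, hGDproj, hRPproj⟩, fun hC => ?_⟩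
  have hGDnorm := LinearERM.tendsto_norm_atTop x hn hℓ hy0 hC hmin hGD
  have hRPnorm := LinearERM.tendsto_norm_atTop x hn hℓ hy0 hC hmin hRP
  have hGDnorm' := (tendsto_add_atTop_iff_nat (f := fun t => ‖w t‖) t₀).2 hGDnorm
  have hGDRP : ∀ u, Tendsto (fun t => (1 / ‖w t‖) • w t) atTop (𝓝 u) →
      Tendsto (fun B => (1 / B) • wbar B) atTop (𝓝 u) := fun u hu =>
    hdesc.tendsto_path_of_tendsto_direction hη hnonneg hwbar hGDnorm'
      ((tendsto_add_atTop_iff_nat (f := fun t => (1 / ‖w t‖) • w t) t₀).2 hu)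
  have hRPGD : ∀ u, Tendsto (fun B => (1 / B) • wbar B) atTop (𝓝 u) →
      Tendsto (fun t => (1 / ‖w t‖) • w t) atTop (𝓝 u) := by
    intro u hu
    have hu1 : ‖u‖ ≤ 1 := by
      refine le_of_tendsto hu.norm ?_
      filter_upwards [eventually_gt_atTop 0] with B hB
      rw [norm_smul, Real.norm_of_nonneg (by positivity), one_div, inv_mul_le_iff₀ hB, mul_one]
      exact (hwbar B hB.le).1
    have huS := (LinearERM.mem_spanS_orthogonal_iff x hy0).1
      (LinearERM.mem_orthogonal_of_tendsto tendsto_id hRPproj hu)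
    have huC := LinearERM.margin_pos_of_tendsto_path x hn hℓ hy0 hwbar hRPproj hu
    exact (tendsto_add_atTop_iff_nat (f := fun t => (1 / ‖w t‖) • w t) t₀).1
      (hdesc.tendsto_direction_of_ray hη hnonneg hGDnorm' hu1 fun α hα =>
        LinearERM.risk_ray_le x hℓ hy0 hwbar hmin huS huC hu hα)
  refine ⟨hGDnorm, hRPnorm, ⟨fun ⟨u, hu⟩ => ⟨u, hGDRP u hu⟩, fun ⟨u, hu⟩ => ⟨u, hRPGD u hu⟩⟩,
    fun u u' hu hu' => ⟨tendsto_nhds_unique (hGDRP u hu) hu', ?_⟩⟩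
  exact LinearERM.mem_orthogonal_of_tendsto hGDnorm hGDproj hu
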